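/- Let $G$ be a countable discrete (necessarily nonamenable) group containing a free subgroup on two generators, and let $G \curvearrowright X$ be an action by homeomorphisms on a compact metrizable space $X$. Suppose that the action is topologically amenable, i.e. there is a sequence of continuous maps $\mu_n : X \to \mathrm{Prob}(G)$, where $\mathrm{Prob}(G)$ is the space of probability measures on $G$ with the $\ell^1$-norm and $G$ acts on it by left translation, such that $\sup_{x\in X}\|g\mu_n(x)-\mu_n(gx)\|_1 \to 0$ for every $g \in G$. Then there exists a $G$-equivariant topological embedding of $X$ into $[0,1]^G$, where $[0,1]^G$ carries the product topology and $G$ acts on it by the left shift $(g\omega)(h) = \omega(g^{-1}h)$. -/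

import Mathlib

open Filter Topology

/-- The left translation action of `G` on `ℓ¹(G)`: `(g p)(h) = p (g⁻¹ h)`, i.e. the push-forward of
the (signed) measure `p` under left multiplication by `g`. -/
def translateL1 {G : Type*} [Group G] (g : G) (p : lp (fun _ : G => ℝ) 1) :
    lp (fun _ : G => ℝ) 1 :=
  ⟨fun h => p (g⁻¹ * h), by
    have h1 : Summable fun h : G => ‖p h‖ ^ (1 : ENNReal).toReal :=
      (lp.memℓp p).summable (by simp)
    exact memℓp_gen (h1.comp_injective (mul_right_injective g⁻¹))⟩

/-- `Prob(G)`, the space of probability measures on the discrete group `G`, as a subset of `ℓ¹(G)`,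
from which it inherits the `ℓ¹`-norm and the topology. -/
def probSpace (G : Type*) : Set (lp (fun _ : G => ℝ) 1) :=
  {p | (∀ h : G, 0 ≤ p h) ∧ HasSum (fun h : G => p h) 1}

/-- Topological amenability of an action: there are continuous maps `μ n : X → Prob(G)` such that
`sup_x ‖g μ_n(x) - μ_n(g x)‖₁ → 0` for every `g`. -/
def TopologicallyAmenable (G X : Type*) [Group G] [TopologicalSpace X] [MulAction G X] : Prop :=
  ∃ μ : ℕ → X → lp (fun _ : G => ℝ) 1,
    (∀ n, Continuous (μ n)) ∧ (∀ n x, μ n x ∈ probSpace G) ∧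
      ∀ g : G, ∀ ε : ℝ, 0 < ε →
        ∀ᶠ n in atTop, ∀ x : X, ‖translateL1 g (μ n x) - μ n (g • x)‖ < ε

/-- The left shift action on `[0,1]^G` (with the product topology): `(g ω)(h) = ω (g⁻¹ h)`. -/
def leftShift {G : Type*} [Group G] (g : G) (ω : G → Set.Icc (0 : ℝ) 1) :
    G → Set.Icc (0 : ℝ) 1 :=
  fun h => ω (g⁻¹ * h)

/-! It suffices to find one continuous f : X → [0,1] whose translates separate points, since x ↦
(f(h⁻¹x))_h is then a continuous equivariant injection of a compact space. Such an f is a uniform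
limit of stages. Each passage (`Stage.exists_next`) encodes one member φ of a separating sequence
and keeps an open set O, where the function vanishes, free for later ones.

The difficulty is to locate the encoded values from f alone. Almost equivariant maps X → Prob(G)
reduce this to ping-pong on G: positive words of equal length carry the set A to disjoint cones, and
a point of X is labelled by the cones that hold more than half of its measure. One label is a marker
where f reaches its top value η. Other labels carry η φ / 2 at a translate. A last one is reserved
for later stages, whose values there are at most η / 2. Hence the value η on L reveals the marker
whatever happens later, and known words lead from the marker to the data. -/

/-- Two elements `γ c` of a group with disjoint sets `U c` which they attract: `γ c` maps into
`U c` both sets `U d` as well as every point that the other element does not attract. -/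
structure PingPong (G : Type*) [Group G] where
  γ : Bool → G
  U : Bool → Set G
  disj : ∀ {y c d}, y ∈ U c → y ∈ U d → c = d
  pos : ∀ {c d y}, y ∈ U d → γ c * y ∈ U c
  cover : ∀ {c d} y, c ≠ d → γ c * y ∈ U c ∨ γ d * y ∈ U d

/-! ### Ping-pong in free groups and in groups containing them -/

namespace FreeGroup

theorem head_toWord_of_mul {α : Type*} [DecidableEq α] (i : α) (x : FreeGroup α)
    (hx : x.toWord.head? ≠ some (i, false)) :
    (of i * x).toWord.head? = some (i, true) := by
  have h : of i * x = mk ((i, true) :: x.toWord) := by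
    conv_lhs => rw [← mk_toWord (x := x)]
    rw [of, mul_mk, List.singleton_append]
  rw [h, toWord_mk, reduce.cons, reduce_toWord]
  cases hw : x.toWord with
  | nil => simp
  | cons p l =>
    obtain ⟨j, b⟩ := p
    rw [hw] at hx
    simp only [List.head?_cons, ne_eq, Option.some.injEq, Prod.mk.injEq, not_and,
      Bool.not_eq_false] at hx
    by_cases hij : i = j
    · have := hx hij.symm
      simp [this]
    · simp [hij]

/-- Words beginning with a positive letter form ping-pong sets for the two generators. -/
def pingPong : PingPong (FreeGroup Bool) where
  γ := of
  U c := {x | x.toWord.head? = some (c, true)}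
  disj := by
    intro y c d hc hd
    simp only [Set.mem_ofPred_eq] at hc hd
    rw [hc] at hd
    simpa using hd
  pos := by
    intro c d y hy
    apply head_toWord_of_mul
    simp only [Set.mem_ofPred_eq] at hy
    simp [hy]
  cover := by
    intro c d y hcd
    by_cases h : y.toWord.head? = some (c, false)
    · right
      apply head_toWord_of_mul
      simp [h, hcd]
    · exact Or.inl (head_toWord_of_mul _ _ h)

end FreeGroup

/-- A choice of representatives identifies each right coset of `H` with `H`, equivariantly. -/
theorem Subgroup.exists_equivariant_retraction {G : Type*} [Group G] (H : Subgroup G) :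
    ∃ ρ : G → H, ∀ (h : H) (g : G), ρ (h * g) = h * ρ g := by
  let s := QuotientGroup.rightRel H
  have key : ∀ g : G, g * (Quotient.mk s g).out⁻¹ ∈ H := fun g =>
    QuotientGroup.rightRel_apply.1 (Quotient.mk_out (s := s) g)
  refine ⟨fun g => ⟨_, key g⟩, fun h g => Subtype.ext ?_⟩
  have : Quotient.mk s (h * g) = Quotient.mk s g := by
    refine Quotient.sound (QuotientGroup.rightRel_apply.2 ?_)
    simp
  simp [this, mul_assoc]

namespace PingPong

/-- Ping-pong sets pull back along equivariant maps. -/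
def comap {F G : Type*} [Group F] [Group G] (P : PingPong F) (j : F → G) (ρ : G → F)
    (h : ∀ x g, ρ (j x * g) = x * ρ g) : PingPong G where
  γ c := j (P.γ c)
  U c := ρ ⁻¹' P.U c
  disj := P.disj
  pos := by
    intro c d y hy
    simpa [h] using P.pos hy
  cover := by
    intro c d y hcd
    simpa [h] using P.cover (ρ y) hcd

theorem nonempty_of_freeGroup {G : Type*} [Group G]
    (hF : ∃ H : Subgroup G, Nonempty (FreeGroup (Fin 2) ≃* H)) : Nonempty (PingPong G) := by
  obtain ⟨H, ⟨e⟩⟩ := hF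
  obtain ⟨ρ, hρ⟩ := H.exists_equivariant_retraction
  let e' : FreeGroup Bool ≃* H :=
    (FreeGroup.freeGroupCongr finTwoEquiv.symm).trans e
  refine ⟨FreeGroup.pingPong.comap (fun x => (e' x : G)) (fun g => e'.symm (ρ g)) ?_⟩
  intro x g
  simp [hρ]

/-! ### Combinatorics of positive words -/

variable {G : Type*} [Group G] (P : PingPong G)

/-- The group element represented by a positive word. -/
def word (l : List Bool) : G := (l.map P.γ).prod

/-- The union of the two ping-pong sets. -/
def A : Set G := {y | ∃ c, y ∈ P.U c}

@[simp] theorem word_nil : P.word [] = 1 := rfl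

@[simp] theorem word_cons (c : Bool) (l : List Bool) : P.word (c :: l) = P.γ c * P.word l := by
  simp [word]

@[simp] theorem word_append (l l' : List Bool) : P.word (l ++ l') = P.word l * P.word l' := by
  simp [word]

theorem mem_U_of_mem_A {y : G} (hy : y ∈ P.A) (c : Bool) : P.γ c * y ∈ P.U c :=
  P.pos hy.choose_spec

theorem word_mul_mem {y : G} (hy : y ∈ P.A) (l : List Bool) : P.word l * y ∈ P.A := by
  induction l with
  | nil => simpa using hy
  | cons c l ih =>
    rw [word_cons, mul_assoc]
    exact ⟨c, P.mem_U_of_mem_A ih c⟩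

/-- The set `U c` containing the point reveals the first letter; cancel it and recurse. -/
theorem word_injective {l l' : List Bool} (hl : l.length = l'.length) {y y' : G}
    (hy : y ∈ P.A) (hy' : y' ∈ P.A) (h : P.word l * y = P.word l' * y') : l = l' := by
  induction l generalizing l' with
  | nil => exact (List.length_eq_zero_iff.1 hl.symm).symm
  | cons c l ih =>
    cases l' with
    | nil => simp at hl
    | cons d l' =>
      simp only [word_cons, mul_assoc] at h
      have hc := P.mem_U_of_mem_A (P.word_mul_mem hy l) c
      have hd := P.mem_U_of_mem_A (P.word_mul_mem hy' l') d
      rw [h] at hc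
      obtain rfl := P.disj hc hd
      rw [ih (by simpa using hl) (mul_left_cancel h)]

/-- Past the longest common suffix, `cover` puts one of the two images in `A`, and further letters
keep it there. -/
theorem word_cover {l l' : List Bool} (hl : l.length = l'.length) (hne : l ≠ l') (x : G) :
    P.word l * x ∈ P.A ∨ P.word l' * x ∈ P.A := by
  induction l generalizing l' with
  | nil => exact absurd (List.length_eq_zero_iff.1 hl.symm).symm hne
  | cons c l ih =>
    cases l' with
    | nil => simp at hl
    | cons d l' =>
      simp only [word_cons, mul_assoc]
      by_cases hll : l = l'
      · subst hll
        have hcd : c ≠ d := fun h => hne (by rw [h])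
        exact (P.cover (P.word l * x) hcd).imp (fun h => ⟨_, h⟩) (fun h => ⟨_, h⟩)
      · exact (ih (by simpa using hl) hll).imp (fun h => ⟨_, P.mem_U_of_mem_A h c⟩)
          (fun h => ⟨_, P.mem_U_of_mem_A h d⟩)

/-- A positive word pushes into `A` any point which another positive word, shorter by one letter,
takes to a point of `e₂ A` with `e₂` as long as that other word. -/
theorem word_mul_mem_of_word_mul_eq (n : ℕ) : ∀ {e₁ e₂ w : List Bool}, e₁.length = n →
    e₂.length = n → w.length = n + 1 → ∀ {y v : G}, v ∈ P.A →
    P.word e₁ * y = P.word e₂ * v → P.word w * y ∈ P.A := by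
  induction n with
  | zero =>
    intro e₁ e₂ w h₁ h₂ _ y v hv h
    rw [List.length_eq_zero_iff.1 h₁, List.length_eq_zero_iff.1 h₂] at h
    obtain rfl : y = v := by simpa using h
    exact P.word_mul_mem hv w
  | succ n ih =>
    intro e₁ e₂ w h₁ h₂ hw y v hv h
    rcases List.eq_nil_or_concat e₁ with rfl | ⟨e₁, c, rfl⟩
    · simp at h₁
    rcases List.eq_nil_or_concat e₂ with rfl | ⟨e₂, d, rfl⟩
    · simp at h₂
    rcases List.eq_nil_or_concat w with rfl | ⟨w, c', rfl⟩
    · simp at hw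
    simp only [List.concat_eq_append, List.length_append, List.length_cons, List.length_nil,
      zero_add, Nat.add_right_cancel_iff] at h₁ h₂ hw
    simp only [List.concat_eq_append, word_append, word_cons, word_nil, mul_one, mul_assoc] at h ⊢
    have hd := P.mem_U_of_mem_A hv d
    -- A shared last letter is absorbed into `y`, and `d` into `v`. Otherwise, failure would force
    -- `e₁ = e₂`, then `y = v ∈ A`, a contradiction.
    by_cases hc : c' = c
    · subst hc
      exact ih h₁ h₂ hw ⟨d, hd⟩ h
    · apply P.word_mul_mem
      by_contra hy
      have hcy : P.γ c * y ∈ P.U c :=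
        (P.cover y hc).resolve_left fun h' => hy ⟨_, h'⟩
      obtain rfl := P.word_injective (h₁.trans h₂.symm) ⟨_, hcy⟩ ⟨_, hd⟩ h
      have hyv := mul_left_cancel h
      rw [hyv] at hcy
      obtain rfl := P.disj hcy hd
      rw [mul_left_cancel hyv] at hy
      exact hy ⟨_, P.mem_U_of_mem_A hv c'⟩

end PingPong

/-! ### Masses of subsets of the group -/

section Mass

variable {G : Type*}

/-- The total mass that an element of `ℓ¹(G)` gives to a subset of `G`. -/
noncomputable def mass (B : Set G) (p : lp (fun _ : G => ℝ) 1) : ℝ :=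
  ∑' h, B.indicator (fun h => p h) h

theorem lp_one_hasSum_norm (p : lp (fun _ : G => ℝ) 1) : HasSum (fun h => |p h|) ‖p‖ := by
  simpa using lp.hasSum_norm (by simp) p

theorem lp_one_summable_indicator (B : Set G) (p : lp (fun _ : G => ℝ) 1) :
    Summable (B.indicator fun h => p h) :=
  ((lp_one_hasSum_norm p).summable.of_abs).indicator B

theorem mass_sub (B : Set G) (p q : lp (fun _ : G => ℝ) 1) :
    mass B (p - q) = mass B p - mass B q := by
  rw [mass, mass, mass,
    ← (lp_one_summable_indicator B p).tsum_sub (lp_one_summable_indicator B q)]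
  congr 1 with h
  by_cases hB : h ∈ B <;> simp [hB]

theorem abs_mass_le (B : Set G) (p : lp (fun _ : G => ℝ) 1) : |mass B p| ≤ ‖p‖ := by
  have hs := (lp_one_hasSum_norm p).summable
  have h1 : ∀ h, |B.indicator (fun h => p h) h| ≤ |p h| := fun h => by
    by_cases hB : h ∈ B <;> simp [hB]
  rw [← (lp_one_hasSum_norm p).tsum_eq, mass, abs_le]
  constructor
  · rw [← tsum_neg]
    exact hs.neg.tsum_le_tsum (fun h => (abs_le.1 (h1 h)).1) (lp_one_summable_indicator B p)
  · exact (lp_one_summable_indicator B p).tsum_le_tsum (fun h => (abs_le.1 (h1 h)).2) hs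

theorem abs_mass_sub_mass_le (B : Set G) (p q : lp (fun _ : G => ℝ) 1) :
    |mass B p - mass B q| ≤ ‖p - q‖ := by
  rw [← mass_sub]
  exact abs_mass_le B _

theorem continuous_mass (B : Set G) : Continuous (mass B) := by
  refine LipschitzWith.continuous (K := 1) (LipschitzWith.of_dist_le_mul fun p q => ?_)
  simpa [Real.dist_eq, dist_eq_norm] using abs_mass_sub_mass_le B p q

theorem mass_mono {B C : Set G} (h : B ⊆ C) {p : lp (fun _ : G => ℝ) 1} (hp : p ∈ probSpace G) :
    mass B p ≤ mass C p :=
  (lp_one_summable_indicator B p).tsum_le_tsum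
    (fun x => Set.indicator_le_indicator_of_subset h hp.1 x) (lp_one_summable_indicator C p)

theorem sum_mass_le_one {ι : Type*} [Fintype ι] {B : ι → Set G}
    (hB : ∀ i j h, h ∈ B i → h ∈ B j → i = j) {p : lp (fun _ : G => ℝ) 1}
    (hp : p ∈ probSpace G) : ∑ i, mass (B i) p ≤ 1 := by
  unfold mass
  rw [← Summable.tsum_finsetSum fun i _ => lp_one_summable_indicator (B i) p, ← hp.2.tsum_eq]
  refine (summable_sum fun i _ => lp_one_summable_indicator (B i) p).tsum_le_tsum
    (fun h => ?_) hp.2.summable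
  by_cases hh : ∃ i, h ∈ B i
  · obtain ⟨i, hi⟩ := hh
    rw [Finset.sum_eq_single i]
    · simp [hi]
    · intro j _ hj
      exact Set.indicator_of_notMem (fun hj' => hj (hB _ _ _ hj' hi)) _
    · simp
  · push Not at hh
    simpa [hh] using hp.1 h

theorem mass_add_mass_le_one {B C : Set G} (h : Disjoint B C) {p : lp (fun _ : G => ℝ) 1}
    (hp : p ∈ probSpace G) : mass B p + mass C p ≤ 1 := by
  have := sum_mass_le_one (B := fun b : Bool => if b then B else C) (fun i j x hi hj => ?_) hp
  · simpa using this
  · have : x ∈ B → x ∉ C := fun hb => Set.disjoint_left.1 h hb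
    cases i <;> cases j <;> simp_all

theorem mass_compl (B : Set G) {p : lp (fun _ : G => ℝ) 1} (hp : p ∈ probSpace G) :
    mass Bᶜ p = 1 - mass B p := by
  have h := (lp_one_summable_indicator B p).tsum_add (lp_one_summable_indicator Bᶜ p)
  have h2 : ∀ x, B.indicator (fun h => p h) x + Bᶜ.indicator (fun h => p h) x = p x :=
    fun x => congrFun (Set.indicator_self_add_compl B fun h => p h) x
  simp only [h2, hp.2.tsum_eq] at h
  unfold mass
  linarith

theorem mass_translateL1 [Group G] (B : Set G) (g : G) (p : lp (fun _ : G => ℝ) 1) :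
    mass B (translateL1 g p) = mass {h | g * h ∈ B} p := by
  unfold mass
  rw [← (Equiv.mulLeft g).tsum_eq]
  congr 1 with h
  by_cases hB : g * h ∈ B <;> simp [translateL1, Set.indicator, hB]

end Mass

namespace PingPong

variable {G : Type*} [Group G] (P : PingPong G)

/-- Every probability measure is moved by some word of length two to one that gives most of its
mass to `A`. -/
theorem exists_mass_ge {p : lp (fun _ : G => ℝ) 1} (hp : p ∈ probSpace G) :
    ∃ s : Bool × Bool, 3 / 4 ≤ mass {h | P.word [s.1, s.2] * h ∈ P.A} p := by
  by_contra! hlt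
  -- By `word_cover` the four complements are disjoint, so they cannot all have mass above 1/4.
  have h := sum_mass_le_one (B := fun s : Bool × Bool => {h | P.word [s.1, s.2] * h ∈ P.A}ᶜ)
    (fun s t x hs ht => ?_) hp
  · have : ∑ s : Bool × Bool, (1 / 4 : ℝ) <
        ∑ s : Bool × Bool, mass {h | P.word [s.1, s.2] * h ∈ P.A}ᶜ p := by
      refine Finset.sum_lt_sum_of_nonempty Finset.univ_nonempty fun s _ => ?_
      rw [mass_compl _ hp]
      linarith [hlt s]
    refine (this.trans_le h).ne ?_
    norm_num
  · by_contra hst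
    have hne : [s.1, s.2] ≠ [t.1, t.2] := fun h => hst (by simpa [Prod.ext_iff] using h)
    exact (P.word_cover (by simp) hne x).elim hs ht

end PingPong

theorem TopologicallyAmenable.exists_almost_equivariant {G X : Type*} [Group G]
    [TopologicalSpace X] [MulAction G X] (hX : TopologicallyAmenable G X) {S : Set G}
    (hS : S.Finite) {ε : ℝ} (hε : 0 < ε) :
    ∃ μ : X → lp (fun _ : G => ℝ) 1, Continuous μ ∧ (∀ x, μ x ∈ probSpace G) ∧
      ∀ g ∈ S, ∀ x B, |mass {h | g * h ∈ B} (μ x) - mass B (μ (g • x))| < ε := by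
  obtain ⟨μ, hc, hp, hμ⟩ := hX
  obtain ⟨n, hn⟩ := ((eventually_all_finite hS).2 fun g _ => hμ g ε hε).exists
  refine ⟨μ n, hc n, hp n, fun g hg x B => ?_⟩
  rw [← mass_translateL1]
  exact (abs_mass_sub_mass_le _ _ _).trans_lt (hn g hg x)

/-! ### Stages, ramps and cones -/

/-- The function `g` agrees with `f` off `O`, and has values in `[0, η]` on `O`. -/
def IsModification {X : Type*} (f : X → ℝ) (O : Set X) (η : ℝ) (g : X → ℝ) : Prop :=
  (∀ z ∉ O, g z = f z) ∧ ∀ z ∈ O, 0 ≤ g z ∧ g z ≤ η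

/-- The function `g` takes the same values along the orbits of `x` and `y`. -/
def Indistinguishable (G : Type*) {X : Type*} [SMul G X] (g : X → ℝ) (x y : X) : Prop :=
  ∀ h : G, g (h • x) = g (h • y)

theorem Indistinguishable.smul {G X : Type*} [Group G] [MulAction G X] {g : X → ℝ} {x y : X}
    (h : Indistinguishable G g x y) (k : G) : Indistinguishable G g (k • x) (k • y) := fun l => by
  simpa [mul_smul] using h (l * k)

/-- A continuous function vanishing on an open set `O`, with a closed subset `L` of `O` that meets
all orbits and that every modification of the function on `O` recognizes. -/
structure Stage {G : Type*} [Group G] (P : PingPong G) (X : Type*) [TopologicalSpace X]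
    [MulAction G X] where
  f : X → ℝ
  L : Set X
  O : Set X
  R : ℕ
  η : ℝ
  continuous_f : Continuous f
  isClosed_L : IsClosed L
  isOpen_O : IsOpen O
  subset : L ⊆ O
  eq_zero : ∀ z ∈ O, f z = 0
  η_pos : 0 < η
  cover : ∀ x, ∃ e : List Bool, e.length = R ∧ P.word e • x ∈ L
  recognize : ∀ g, IsModification f O η g → ∀ z z', z ∈ L → Indistinguishable G g z z' → z' ∈ L

/-- The piecewise linear function that is `0` below `3 / 5` and has slope `c` until it reaches
`1`. -/
noncomputable def ramp (c t : ℝ) : ℝ := max 0 (min 1 ((t - 3 / 5) * c))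

theorem continuous_ramp (c : ℝ) : Continuous (ramp c) := by
  unfold ramp
  fun_prop

theorem ramp_nonneg (c t : ℝ) : 0 ≤ ramp c t := le_max_left _ _

theorem ramp_le_one (c t : ℝ) : ramp c t ≤ 1 := max_le zero_le_one (min_le_left _ _)

theorem ramp_eq_zero {c t : ℝ} (hc : 0 ≤ c) (ht : t ≤ 3 / 5) : ramp c t = 0 :=
  max_eq_left ((min_le_right _ _).trans (mul_nonpos_of_nonpos_of_nonneg (by linarith) hc))

theorem ramp_eq_one_iff {c t : ℝ} : ramp c t = 1 ↔ 1 ≤ (t - 3 / 5) * c := by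
  unfold ramp
  constructor
  · intro h
    by_contra! hlt
    have : max 0 (min 1 ((t - 3 / 5) * c)) < 1 :=
      max_lt zero_lt_one ((min_le_right _ _).trans_lt hlt)
    exact this.ne h
  · intro h
    rw [min_eq_left h, max_eq_right zero_le_one]

theorem isClosed_exists_length_eq {X : Type*} [TopologicalSpace X] (n : ℕ)
    {C : List Bool → Set X} (hC : ∀ e, IsClosed (C e)) :
    IsClosed {z | ∃ e : List Bool, e.length = n ∧ z ∈ C e} := by
  have : {z | ∃ e : List Bool, e.length = n ∧ z ∈ C e} =
      ⋃ e ∈ {e : List Bool | e.length = n}, C e := by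
    ext z
    simp
  rw [this]
  exact (List.finite_length_eq Bool n).isClosed_biUnion fun e _ => hC e

namespace PingPong

variable {G : Type*} [Group G] (P : PingPong G)

/-- The image of `A` under a positive word. -/
def cone (q : List Bool) : Set G := {x | ∃ a ∈ P.A, x = P.word q * a}

/-- The union of the cones of the words that extend words of length `n` by `p`. -/
def fan (n : ℕ) (p : List Bool) : Set G := {x | ∃ e, e.length = n ∧ x ∈ P.cone (e ++ p)}

theorem disjoint_cone {q q' : List Bool} (hq : q.length = q'.length) (hne : q ≠ q') :
    Disjoint (P.cone q) (P.cone q') := by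
  rw [Set.disjoint_left]
  rintro x ⟨a, ha, rfl⟩ ⟨a', ha', h⟩
  exact hne (P.word_injective hq ha ha' h)

theorem disjoint_fan (n : ℕ) {p p' : List Bool} (hp : p.length = p'.length) (hne : p ≠ p') :
    Disjoint (P.fan n p) (P.fan n p') := by
  rw [Set.disjoint_left]
  rintro x ⟨e, he, hx⟩ ⟨e', he', hx'⟩
  refine Set.disjoint_left.1 (P.disjoint_cone ?_ ?_) hx hx'
  · simp [he, he', hp]
  · intro h
    exact hne (List.append_inj h (he.trans he'.symm)).2

theorem cone_subset_fan (e p : List Bool) : P.cone (e ++ p) ⊆ P.fan e.length p :=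
  fun _ hx => ⟨e, rfl, hx⟩

end PingPong

/-- If the sum of any two of finitely many numbers is at most `1`, then at most one term of a sum
weighted by their ramps survives. -/
theorem sum_ramp_mul_eq_single {ι : Type*} [DecidableEq ι] {s : Finset ι} {κ ψ : ι → ℝ} {c : ℝ}
    (hc : 0 ≤ c) (hκ : ∀ i ∈ s, ∀ j ∈ s, i ≠ j → κ i + κ j ≤ 1) {i : ι} (hi : i ∈ s)
    (h : 3 / 5 < κ i) : ∑ j ∈ s, ramp c (κ j) * ψ j = ramp c (κ i) * ψ i := by
  refine Finset.sum_eq_single i (fun j hj hji => ?_) (fun h => absurd hi h)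
  rw [ramp_eq_zero hc (by linarith [hκ j hj i hi hji]), zero_mul]

theorem sum_ramp_mul_eq_zero {ι : Type*} {s : Finset ι} {κ ψ : ι → ℝ} {c : ℝ}
    (hc : 0 ≤ c) (hκ : ∀ i ∈ s, κ i ≤ 3 / 5) : ∑ j ∈ s, ramp c (κ j) * ψ j = 0 :=
  Finset.sum_eq_zero fun i hi => by rw [ramp_eq_zero hc (hκ i hi), zero_mul]

theorem sum_ramp_mul_mem {ι : Type*} {s : Finset ι} {κ ψ : ι → ℝ} {c b : ℝ}
    (hc : 0 ≤ c) (hκ : ∀ i ∈ s, ∀ j ∈ s, i ≠ j → κ i + κ j ≤ 1) (hb : 0 ≤ b)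
    (hψ : ∀ i, ψ i ∈ Set.Icc 0 b) : ∑ j ∈ s, ramp c (κ j) * ψ j ∈ Set.Icc 0 b := by
  classical
  by_cases h : ∃ i ∈ s, 3 / 5 < κ i
  · obtain ⟨i, hi, h⟩ := h
    rw [sum_ramp_mul_eq_single hc hκ hi h]
    refine ⟨mul_nonneg (ramp_nonneg _ _) (hψ i).1, ?_⟩
    nlinarith [ramp_le_one c (κ i), ramp_nonneg c (κ i), (hψ i).1, (hψ i).2]
  · push Not at h
    rw [sum_ramp_mul_eq_zero hc h]
    exact ⟨le_rfl, hb⟩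

/-! ### The inductive step -/

namespace Stage

variable {G : Type*} [Group G] {P : PingPong G} {X : Type*} [TopologicalSpace X] [MulAction G X]

/-- The modifications of the function of a stage that the stage allows. -/
def Allows (S : Stage P X) (g : X → ℝ) : Prop := IsModification S.f S.O S.η g

theorem allows_self (S : Stage P X) : S.Allows S.f :=
  ⟨fun _ _ => rfl, fun z hz => by simp [S.eq_zero z hz, S.η_pos.le]⟩

theorem Allows.abs_sub_le {S : Stage P X} {g : X → ℝ} (h : S.Allows g) (z : X) :
    |g z - S.f z| ≤ S.η := by
  by_cases hz : z ∈ S.O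
  · rw [S.eq_zero z hz, sub_zero, abs_of_nonneg (h.2 z hz).1]
    exact (h.2 z hz).2
  · rw [h.1 z hz, sub_self, abs_zero]
    exact S.η_pos.le

/-- The stage of the zero function. -/
def initial (P : PingPong G) (X : Type*) [TopologicalSpace X] [MulAction G X] : Stage P X where
  f _ := 0
  L := Set.univ
  O := Set.univ
  R := 0
  η := 1
  continuous_f := continuous_const
  isClosed_L := isClosed_univ
  isOpen_O := isOpen_univ
  subset := subset_rfl
  eq_zero _ _ := rfl
  η_pos := one_pos
  cover _ := ⟨[], rfl, trivial⟩
  recognize _ _ _ _ _ _ := trivial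

variable [CompactSpace X] [T2Space X] [ContinuousConstSMul G X]

/-- Quantifying over all allowed `g`, rather than the new function alone, lets the encoding of `φ`
survive in the limit. -/
theorem exists_next (hX : TopologicallyAmenable G X) (S : Stage P X) {φ : X → ℝ}
    (hφ : Continuous φ) (hφ01 : ∀ x, φ x ∈ Set.Icc (0 : ℝ) 1) :
    ∃ S' : Stage P X, S'.η = S.η / 2 ∧ (∀ g, S'.Allows g → S.Allows g) ∧
      ∀ g, S'.Allows g → ∀ x y, Indistinguishable G g x y → φ x = φ y := by
  classical
  obtain ⟨f, L, O, R, η, hf, hL, hO, hLO, hfO, hη, hcov, hrec⟩ := S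
  obtain ⟨μ, hμc, hμp, happ'⟩ := hX.exists_almost_equivariant
    -- The words used have length at most `R + 5` or `2 * R + 4`. The error 1/100 leaves room in the
    -- descent 3/4, 13/20, 31/50, 3/5 of mass thresholds.
    (S := P.word '' {l | l.length ≤ 2 * R + 10}) ((List.finite_length_le Bool _).image _)
    (ε := 1 / 100) (by norm_num)
  have happ : ∀ l : List Bool, l.length ≤ 2 * R + 10 → ∀ x B,
      |mass {h | P.word l * h ∈ B} (μ x) - mass B (μ (P.word l • x))| < 1 / 100 :=
    fun l hl => happ' _ ⟨l, hl, rfl⟩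
  clear happ'
  -- One letter longer than the words of `cover`, as `word_mul_mem_of_word_mul_eq` requires.
  set w : List Bool := List.replicate (R + 1) true with hw
  have hwl : w.length = R + 1 := by simp [hw]
  -- Distinct labels of length 3: `m` is the marker, `r` is reserved for later stages, and `p s`
  -- carries data.
  set m : List Bool := [false, false, false] with hm
  set r : List Bool := [false, true, true] with hr
  let p : Bool × Bool → List Bool := fun s => [true, s.1, s.2]
  let t : Bool × Bool → List Bool := fun s => [s.1, s.2]
  let β : List Bool → X → ℝ := fun q z => mass (P.fan R q) (μ z)
  let κ : List Bool → X → ℝ := fun q z => mass (P.cone q) (μ z)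
  have hβc : ∀ q, Continuous (β q) := fun q => (continuous_mass _).comp hμc
  have hκc : ∀ q, Continuous (κ q) := fun q => (continuous_mass _).comp hμc
  have hκκ : ∀ q q' z, q.length = q'.length → q ≠ q' → κ q z + κ q' z ≤ 1 :=
    fun q q' z hl hne => mass_add_mass_le_one (P.disjoint_cone hl hne) (hμp z)
  have hββ : ∀ q q' z, q.length = q'.length → q ≠ q' → β q z + β q' z ≤ 1 :=
    fun q q' z hl hne => mass_add_mass_le_one (P.disjoint_fan R hl hne) (hμp z)
  have hκβ : ∀ e q z, e.length = R → κ (e ++ q) z ≤ β q z := fun e q z he =>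
    mass_mono (he ▸ P.cone_subset_fan e q) (hμp z)
  let T : Set X := {z | z ∈ L ∧ 13 / 20 ≤ β m z}
  have hT : IsClosed T := hL.inter (isClosed_le continuous_const (hβc m))
  let K : Set X := {y | ∃ e : List Bool, e.length = R ∧ P.word e • y ∈ T}
  have hK : IsClosed K := isClosed_exists_length_eq R
    fun e => hT.preimage (continuous_const_smul (P.word e))
  have hKcov : ∀ x, ∃ s, P.word (m ++ t s) • x ∈ K := by
    intro x
    obtain ⟨s, hs⟩ := P.exists_mass_ge (hμp x)
    obtain ⟨e, he, hz⟩ := hcov (P.word (m ++ t s) • x)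
    refine ⟨s, e, he, hz, ?_⟩
    have h1 := happ (e ++ (m ++ t s)) (by simp [he, hm, t]; omega) x (P.fan R m)
    have h2 : mass {h | P.word [s.1, s.2] * h ∈ P.A} (μ x) ≤
        mass {h | P.word (e ++ (m ++ t s)) * h ∈ P.fan R m} (μ x) := by
      refine mass_mono (fun h hh => ?_) (hμp x)
      refine ⟨e, he, P.word (t s) * h, hh, ?_⟩
      simp only [PingPong.word_append, mul_assoc]
    rw [PingPong.word_append, mul_smul] at h1
    have := (abs_lt.1 h1).2
    rw [← PingPong.word_append] at this
    change _ ≤ mass _ _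
    linarith
  -- The word `e₀` leading from `y` to the marker is unknown, but `w` moves most of the mass of `μ
  -- y` into `A` regardless, so any prescribed cone can then be reached.
  have hKκ : ∀ y ∈ K, ∀ e q : List Bool, e.length = R → q.length = 3 →
      31 / 50 ≤ κ (e ++ q) (P.word (e ++ q ++ w) • y) := by
    rintro y ⟨e₀, he₀, -, hy⟩ e q he hq
    have h1 := (abs_lt.1 (happ e₀ (by omega) y (P.fan R m))).1
    have h2 := (abs_lt.1 (happ (e ++ q ++ w) (by simp [he, hq, hwl]; omega) y
      (P.cone (e ++ q)))).2
    have h3 : mass {h | P.word e₀ * h ∈ P.fan R m} (μ y) ≤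
        mass {h | P.word (e ++ q ++ w) * h ∈ P.cone (e ++ q)} (μ y) := by
      refine mass_mono (fun h hh => ?_) (hμp y)
      obtain ⟨e₂, he₂, a, ha, h4⟩ := hh
      refine ⟨P.word w * h, ?_, by rw [PingPong.word_append _ (e ++ q), mul_assoc]⟩
      rw [PingPong.word_append, mul_assoc] at h4
      exact P.word_mul_mem_of_word_mul_eq R he₀ he₂ hwl (P.word_mul_mem ha m) h4
    change _ ≤ mass _ _ at hy
    change _ ≤ mass _ _
    linarith
  let E : Finset (List Bool) := (List.finite_length_eq Bool R).toFinset
  have hE : ∀ e, e ∈ E ↔ e.length = R := fun e => by simp [E]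
  let I : Finset (List Bool × Bool × Bool) := E ×ˢ Finset.univ
  have hI : ∀ i, i ∈ I ↔ i.1.length = R := fun i => by simp [I, hE]
  let q : List Bool × Bool × Bool → List Bool := fun i => i.1 ++ p i.2
  have hql : ∀ i ∈ I, (q i).length = R + 3 := fun i hi => by simp [q, p, (hI i).1 hi]
  have hqinj : ∀ i ∈ I, ∀ j ∈ I, i ≠ j → q i ≠ q j := by
    rintro ⟨e, s⟩ hi ⟨e', s'⟩ hj hij h
    obtain ⟨h1, h2⟩ := List.append_inj h (((hI _).1 hi).trans ((hI _).1 hj).symm)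
    exact hij (by simpa [p, Prod.ext_iff] using And.intro h1 h2)
  let u : List Bool × Bool × Bool → G := fun i => P.word (q i ++ w) * P.word (m ++ t i.2)
  -- Disjoint cones cannot both have mass above 3/5, so at most one term is nonzero. Slope 50
  -- reaches 1 at 31/50; slope 20, used for the marker, at 13/20.
  let σ : X → ℝ := fun z => ∑ i ∈ I, ramp 50 (κ (q i) z) * (φ ((u i)⁻¹ • z) / 2)
  let h₀ : X → ℝ := fun z => ramp 20 (β m z) + σ z
  have hκI : ∀ z, ∀ i ∈ I, ∀ j ∈ I, i ≠ j → κ (q i) z + κ (q j) z ≤ 1 :=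
    fun z i hi j hj hij => hκκ _ _ z ((hql i hi).trans (hql j hj).symm) (hqinj i hi j hj hij)
  have hσ : ∀ z, σ z ∈ Set.Icc (0 : ℝ) (1 / 2) := fun z =>
    sum_ramp_mul_mem (by norm_num) (hκI z) (by norm_num) fun i =>
      ⟨by linarith [(hφ01 ((u i)⁻¹ • z)).1], by linarith [(hφ01 ((u i)⁻¹ • z)).2]⟩
  have hσ0 : ∀ z l, l.length = 3 → (∀ s, l ≠ p s) → 3 / 5 < β l z → σ z = 0 := by
    intro z l hl hne hz
    refine sum_ramp_mul_eq_zero (by norm_num) fun i hi => ?_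
    linarith [hκβ i.1 (p i.2) z ((hI i).1 hi), hββ l (p i.2) z (by simp [hl, p]) (hne _)]
  have hh₀c : Continuous h₀ := by
    refine ((continuous_ramp _).comp (hβc m)).add (continuous_finsetSum _ fun i _ => ?_)
    exact ((continuous_ramp _).comp (hκc _)).mul
      ((hφ.comp (continuous_const_smul _)).div_const 2)
  have hh₀nn : ∀ z, 0 ≤ h₀ z := fun z => add_nonneg (ramp_nonneg _ _) (hσ z).1
  have hh₀m : ∀ z, 3 / 5 < β m z → h₀ z = ramp 20 (β m z) := fun z hz => by
    simp [h₀, hσ0 z m rfl (by simp [hm, p]) hz]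
  have hh₀le : ∀ z, β m z ≤ 3 / 5 → h₀ z ≤ 1 / 2 := fun z hz => by
    simpa [h₀, ramp_eq_zero (c := 20) (by norm_num) hz] using (hσ z).2
  have hh₀one : ∀ z, h₀ z ≤ 1 := fun z => by
    rcases le_or_gt (β m z) (3 / 5) with hz | hz
    · linarith [hh₀le z hz]
    · exact (hh₀m z hz).trans_le (ramp_le_one _ _)
  have hh₀eq : ∀ z, h₀ z = 1 ↔ 13 / 20 ≤ β m z := fun z => by
    rcases le_or_gt (β m z) (3 / 5) with hz | hz
    · exact ⟨fun h => by linarith [hh₀le z hz], fun h => by linarith⟩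
    · rw [hh₀m z hz, ramp_eq_one_iff]
      constructor <;> intro h <;> linarith
  have hh₀r : ∀ z, 3 / 5 < β r z → h₀ z = 0 := fun z hz => by
    have : β m z ≤ 3 / 5 := by linarith [hββ m r z rfl (by simp [hm, hr])]
    simp [h₀, hσ0 z r rfl (by simp [hr, p]) hz, ramp_eq_zero (c := 20) (by norm_num) this]
  have hh₀i : ∀ z, ∀ i ∈ I, 31 / 50 ≤ κ (q i) z →
      h₀ z = φ ((u i)⁻¹ • z) / 2 ∧ β r z ≤ 3 / 5 := by
    intro z i hi hz
    have h1 := hκβ i.1 (p i.2) z ((hI i).1 hi)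
    have h2 := hββ m (p i.2) z rfl (by simp [hm, p])
    have h3 := hββ r (p i.2) z rfl (by simp [hr, p])
    refine ⟨?_, by linarith⟩
    have h4 : σ z = _ := sum_ramp_mul_eq_single (c := 50) (ψ := fun i => φ ((u i)⁻¹ • z) / 2)
      (by norm_num) (hκI z) hi (by linarith)
    rw [ramp_eq_one_iff.2 (by linarith), one_mul] at h4
    simp only [h₀, h4, ramp_eq_zero (c := 20) (t := β m z) (by norm_num) (by linarith), zero_add]
  obtain ⟨χ, hχ0, hχ1, hχ01⟩ := exists_continuous_zero_one_of_isClosed hO.isClosed_compl hL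
    (Set.disjoint_left.2 fun z hz hz' => hz (hLO hz'))
  let f' : X → ℝ := fun z => f z + χ z * (η * h₀ z)
  have hf'c : Continuous f' := hf.add (χ.continuous.mul (continuous_const.mul hh₀c))
  have hf'L : ∀ z ∈ L, f' z = η * h₀ z := fun z hz => by
    have : χ z = 1 := hχ1 hz
    simp [f', hfO z (hLO hz), this]
  have hf'O : ∀ z ∉ O, f' z = f z := fun z hz => by
    have : χ z = 0 := hχ0 hz
    simp [f', this]
  have hf'mem : ∀ z ∈ O, 0 ≤ f' z ∧ f' z ≤ η := fun z hz => by
    have h1 := hh₀nn z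
    have h2 := hχ01 z
    have h3 : η * h₀ z ≤ η := mul_le_of_le_one_right hη.le (hh₀one z)
    have h4 : 0 ≤ η * h₀ z := mul_nonneg hη.le h1
    simp only [f', hfO z hz, zero_add]
    exact ⟨mul_nonneg h2.1 h4, (mul_le_of_le_one_left h4 h2.2).trans h3⟩
  -- Points of `L` reached from `K` through the reserved label, where `h₀` vanishes.
  let L' : Set X := {z | z ∈ L ∧ ∃ e : List Bool, e.length = R ∧
    (P.word (e ++ r ++ w))⁻¹ • z ∈ K}
  have hL' : IsClosed L' := hL.inter (isClosed_exists_length_eq R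
    fun e => hK.preimage (continuous_const_smul (P.word (e ++ r ++ w))⁻¹))
  let O' : Set X := {z | z ∈ O ∧ 3 / 5 < β r z}
  have hO' : IsOpen O' := hO.inter (isOpen_lt continuous_const (hβc r))
  have hL'O' : L' ⊆ O' := by
    rintro z ⟨hz, e, he, hy⟩
    refine ⟨hLO hz, ?_⟩
    have := hKκ _ hy e r he rfl
    rw [smul_inv_smul] at this
    linarith [hκβ e r z he]
  have hmod : ∀ g, IsModification f' O' (η / 2) g → IsModification f O η g := by
    intro g hg
    refine ⟨fun z hz => (hg.1 z fun h => hz h.1).trans (hf'O z hz), fun z hz => ?_⟩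
    by_cases hz' : z ∈ O'
    · exact ⟨(hg.2 z hz').1, by linarith [(hg.2 z hz').2]⟩
    · rw [hg.1 z hz']
      exact hf'mem z hz
  have hTO' : ∀ z ∈ T, z ∉ O' := by
    rintro z ⟨-, hz⟩ ⟨-, hz'⟩
    linarith [hββ m r z rfl (by simp [hm, hr])]
  -- The value `η` cannot occur on `O'`, where `g ≤ η / 2`. So on `L` it forces `h₀ = 1`, that is,
  -- the marker.
  have hrecK : ∀ g, IsModification f' O' (η / 2) g → ∀ y y', y ∈ K →
      Indistinguishable G g y y' → y' ∈ K := by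
    rintro g hg y y' ⟨e, he, hy⟩ hyy
    have hyL := hrec g (hmod g hg) _ _ hy.1 (hyy.smul (P.word e))
    refine ⟨e, he, hyL, (hh₀eq _).1 ?_⟩
    have h1 : g (P.word e • y) = η := by
      rw [hg.1 _ (hTO' _ hy), hf'L _ hy.1, (hh₀eq _).2 hy.2, mul_one]
    have h2 : g (P.word e • y') = η := (hyy _).symm.trans h1
    have h3 : P.word e • y' ∉ O' := fun h => by linarith [(hg.2 _ h).2]
    rw [hg.1 _ h3, hf'L _ hyL] at h2
    exact mul_left_cancel₀ hη.ne' (h2.trans (mul_one η).symm)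
  -- The new length is that of `e ++ r ++ w ++ (m ++ t s)`.
  refine ⟨⟨f', L', O', R + 3 + (R + 1) + 5, η / 2, hf'c, hL', hO', hL'O', ?_, by linarith, ?_, ?_⟩,
    rfl, hmod, ?_⟩
  · rintro z ⟨hz, hz'⟩
    simp [f', hfO z hz, hh₀r z hz']
  · intro x
    obtain ⟨s, hs⟩ := hKcov x
    obtain ⟨e, he, hz⟩ := hcov (P.word (r ++ w) • P.word (m ++ t s) • x)
    refine ⟨e ++ r ++ w ++ (m ++ t s), by simp [he, hr, hwl, hm, t]; omega, ?_⟩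
    have : P.word (e ++ r ++ w ++ (m ++ t s)) • x =
        P.word e • P.word (r ++ w) • P.word (m ++ t s) • x := by
      simp only [PingPong.word_append, mul_smul]
    rw [this]
    refine ⟨hz, e, he, ?_⟩
    rwa [List.append_assoc, PingPong.word_append _ e, ← mul_smul (P.word e), inv_smul_smul]
  · rintro g hg z z' ⟨hz, e, he, hy⟩ hzz
    exact ⟨hrec g (hmod g hg) z z' hz hzz, e, he, hrecK g hg _ _ hy (hzz.smul _)⟩
  · intro g hg x x' hxx
    change IsModification f' O' (η / 2) g at hg
    obtain ⟨s, hs⟩ := hKcov x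
    -- Both points reach `K` by the same word, so the same data position serves both.
    have hs' := hrecK g hg _ _ hs (hxx.smul _)
    obtain ⟨e, he, hz⟩ := hcov (P.word (p s ++ w) • P.word (m ++ t s) • x)
    have key : ∀ x : X, P.word (e ++ p s ++ w) • P.word (m ++ t s) • x =
        P.word e • P.word (p s ++ w) • P.word (m ++ t s) • x := fun x => by
      simp only [PingPong.word_append, mul_smul]
    rw [← key] at hz
    have hzz := (hxx.smul (P.word (m ++ t s))).smul (P.word (e ++ p s ++ w))
    have hz' := hrec g (hmod g hg) _ _ hz hzz
    have hval : ∀ x, P.word (m ++ t s) • x ∈ K →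
        P.word (e ++ p s ++ w) • P.word (m ++ t s) • x ∈ L →
        g (P.word (e ++ p s ++ w) • P.word (m ++ t s) • x) = η * (φ x / 2) := by
      intro x hx hxL
      obtain ⟨h1, h2⟩ := hh₀i _ (e, s) ((hI _).2 he) (hKκ _ hx e (p s) he rfl)
      rw [hg.1 _ fun h => h2.not_gt h.2, hf'L _ hxL, h1]
      simp [u, q, mul_smul]
    have h := hzz 1
    rw [one_smul, one_smul, hval x hs hz, hval x' hs' hz'] at h
    have := mul_left_cancel₀ hη.ne' h
    linarith

end Stage

/-! ### Passage to the limit and the embedding -/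

theorem exists_seq_continuous_separating (X : Type*) [TopologicalSpace X] [CompactSpace X]
    [TopologicalSpace.MetrizableSpace X] : ∃ φ : ℕ → X → ℝ, (∀ n, Continuous (φ n)) ∧
      (∀ n x, φ n x ∈ Set.Icc (0 : ℝ) 1) ∧ ∀ x y, (∀ n, φ n x = φ n y) → x = y := by
  let := TopologicalSpace.metrizableSpaceMetric X
  rcases isEmpty_or_nonempty X with hX | hX
  · exact ⟨fun _ _ => 0, fun _ => continuous_const, fun _ => isEmptyElim, isEmptyElim⟩
  refine ⟨fun n x => min 1 (dist x (TopologicalSpace.denseSeq X n)), fun n => by fun_prop,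
    fun n x => ⟨le_min zero_le_one dist_nonneg, min_le_left _ _⟩, fun x y h => ?_⟩
  have hall : ∀ z, min 1 (dist x z) = min 1 (dist y z) := fun z =>
    congrFun (DenseRange.equalizer (g := fun z => min 1 (dist x z))
      (h := fun z => min 1 (dist y z)) (TopologicalSpace.denseRange_denseSeq X)
      (by fun_prop) (by fun_prop) (funext h)) z
  have h0 := hall x
  rw [dist_self, min_eq_right zero_le_one] at h0
  rcases min_choice 1 (dist y x) with h1 | h1 <;> rw [h1] at h0
  · norm_num at h0
  · exact (dist_eq_zero.1 h0.symm).symm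

section Limit

variable {G : Type*} [Group G] {P : PingPong G} {X : Type*} [TopologicalSpace X] [MulAction G X]

/-- A sequence of stages, each of which allows only what the previous one allows, has a continuous
limit allowed by all of them. -/
theorem Stage.exists_limit (S : ℕ → Stage P X) (hη : ∀ n, (S (n + 1)).η = (S n).η / 2)
    (hS : ∀ n g, (S (n + 1)).Allows g → (S n).Allows g) :
    ∃ f : X → ℝ, Continuous f ∧ ∀ n, (S n).Allows f := by
  have hmono : ∀ n m, n ≤ m → ∀ g, (S m).Allows g → (S n).Allows g := by
    intro n m hnm
    induction m, hnm using Nat.le_induction with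
    | base => exact fun _ h => h
    | succ m _ ih => exact fun g h => ih g (hS m g h)
  have hη' : ∀ n, (S n).η = (S 0).η * (1 / 2) ^ n := by
    intro n
    induction n with
    | zero => simp
    | succ n ih => rw [hη, ih, pow_succ]; ring
  have hlim0 : Tendsto (fun n => (S n).η) atTop (𝓝 0) := by
    rw [funext hη']
    simpa using (tendsto_pow_atTop_nhds_zero_of_lt_one (r := (1 / 2 : ℝ)) (by norm_num)
      (by norm_num)).const_mul (S 0).η
  have hcauchy : ∀ z, ∃ a, Tendsto (fun n => (S n).f z) atTop (𝓝 a) := fun z => by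
    refine cauchySeq_tendsto_of_complete (cauchySeq_of_le_tendsto_0' _ (fun n m hnm => ?_) hlim0)
    rw [Real.dist_eq, abs_sub_comm]
    exact (hmono n m hnm _ (S m).allows_self).abs_sub_le z
  choose f hf using hcauchy
  have hall : ∀ n, (S n).Allows f := fun n => by
    have hev : ∀ᶠ m in atTop, (S n).Allows (S m).f := by
      filter_upwards [eventually_ge_atTop n] with m hm
      exact hmono n m hm _ (S m).allows_self
    refine ⟨fun z hz => ?_, fun z hz => ⟨?_, ?_⟩⟩
    · refine tendsto_nhds_unique (hf z) (tendsto_const_nhds.congr' ?_)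
      filter_upwards [hev] with m hm
      exact (hm.1 z hz).symm
    · exact ge_of_tendsto (hf z) (hev.mono fun m hm => (hm.2 z hz).1)
    · exact le_of_tendsto (hf z) (hev.mono fun m hm => (hm.2 z hz).2)
  refine ⟨f, ?_, hall⟩
  have hunif : TendstoUniformly (fun n => (S n).f) f atTop := by
    rw [Metric.tendstoUniformly_iff]
    intro ε hε
    filter_upwards [hlim0.eventually_lt_const hε] with n hn z
    rw [Real.dist_eq]
    exact ((hall n).abs_sub_le z).trans_lt hn
  exact hunif.continuous (Frequently.of_forall fun n => (S n).continuous_f)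

/-- An action of a group with ping-pong sets that is topologically amenable carries a continuous
function whose translates separate points. -/
theorem TopologicallyAmenable.exists_separating [CompactSpace X]
    [TopologicalSpace.MetrizableSpace X] [ContinuousConstSMul G X]
    (hX : TopologicallyAmenable G X) (P : PingPong G) :
    ∃ f : X → ℝ, Continuous f ∧ (∀ x, f x ∈ Set.Icc (0 : ℝ) 1) ∧
      ∀ x y, Indistinguishable G f x y → x = y := by
  obtain ⟨φ, hφ, hφ01, hsep⟩ := exists_seq_continuous_separating X
  choose next hη hS hφS using fun (n : ℕ) (S : Stage P X) => S.exists_next hX (hφ n) (hφ01 n)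
  let S : ℕ → Stage P X := fun n => Nat.rec (Stage.initial P X) next n
  obtain ⟨f, hf, hall⟩ := Stage.exists_limit S (fun n => hη n (S n)) (fun n => hS n (S n))
  -- The initial stage has `O = X` and `η = 1`, so being allowed by it bounds `f` in [0,1].
  exact ⟨f, hf, fun x => (hall 0).2 x trivial,
    fun x y hxy => hsep x y fun n => hφS n (S n) f (hall (n + 1)) x y hxy⟩

end Limit

theorem theoremB {G : Type*} [Group G] [Countable G]
    (hF : ∃ H : Subgroup G, Nonempty (FreeGroup (Fin 2) ≃* H))
    {X : Type*} [TopologicalSpace X] [CompactSpace X] [TopologicalSpace.MetrizableSpace X]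
    [MulAction G X] [ContinuousConstSMul G X]
    (hX : TopologicallyAmenable G X) :
    ∃ Φ : X → (G → Set.Icc (0 : ℝ) 1),
      IsEmbedding Φ ∧ ∀ (g : G) (x : X), Φ (g • x) = leftShift g (Φ x) := by
  obtain ⟨P⟩ := PingPong.nonempty_of_freeGroup hF
  obtain ⟨f, hf, hf01, hsep⟩ := hX.exists_separating P
  refine ⟨fun x h => ⟨f (h⁻¹ • x), hf01 _⟩, ?_, fun g x => ?_⟩
  · refine (Continuous.isClosedEmbedding ?_ fun x y hxy => hsep x y fun h => ?_).isEmbedding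
    · exact continuous_pi fun h => (hf.comp (continuous_const_smul _)).subtype_mk _
    · simpa using congrArg Subtype.val (congrFun hxy h⁻¹)
  · funext h
    simp [leftShift, mul_smul]
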